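/- Let $T$ be an arbitrary set. For a real-valued stochastic process $X=\{X_t\}_{t\in T}$ whose one-dimensional marginal distributions are all equal, with common upper endpoint $\tau_{\mathrm{up}}=\sup\{x\in\mathbb R:\mathbb P(X_t\le x)<1\}\in(-\infty,\infty]$, the tail correlation function of $X$ is $$\chi^{(X)}(s,t)=\lim_{\tau\uparrow\tau_{\mathrm{up}}}\mathbb P(X_s>\tau\mid X_t>\tau),\qquad s,t\in T,$$ provided that all these limits exist. Let $\mathrm{TCF}(T)\subset\mathbb R^{T\times T}$ be the set of all tail correlation functions of such processes on $T$. Then: 1. A function $\chi:T\times T\to\mathbb R$ belongs to $\mathrm{TCF}(T)$ if and only if its restriction $\chi|_{M\times M}$ belongs to $\mathrm{TCF}(M)$ for every nonempty finite subset $M\subset T$. 2. Consequently $\mathrm{TCF}(T)$ is cut out by a system of affine inequalities, even if $T$ is infinite. More precisely, for every nonempty finite $M\subset T$ there is a finite set $S_M\subset\mathbb R^{M\times M}\times\mathbb R$ such that $$\mathrm{TCF}(M)=\Big\{x\in\mathbb R^{M\times M}:\ \sum_{i,j\in M}c_{ij}x_{ij}\le b\ \text{ for all }(c,b)\in S_M\Big\},$$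 and $$\mathrm{TCF}(T)=\Big\{\chi\in\mathbb R^{T\times T}:\ \sum_{i,j\in M}c_{ij}\,\chi(i,j)\le b\ \text{ for all nonempty finite }M\subset T\text{ and all }(c,b)\in S_M\Big\}.$$ -/

import Mathlib

open MeasureTheory ProbabilityTheory Filter Topology

universe u

/-- The upper endpoint `sup {x : F x < 1} ∈ (-∞, ∞]` of a distribution on the real line,
where `F x = μ (-∞, x]` is its distribution function. -/
noncomputable def upperEndpoint (μ : Measure ℝ) : EReal :=
  sSup ((fun x : ℝ => (x : EReal)) '' {x : ℝ | μ (Set.Iic x) < 1})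

/-- The filter on `ℝ` describing `τ → u` along real thresholds `τ < u`, for an extended real
`u` (it is `atTop` if `u = ∞` and the left neighbourhood filter of `u` if `u` is finite). -/
noncomputable def thresholdsTo (u : EReal) : Filter ℝ :=
  Filter.comap (fun x : ℝ => (x : EReal)) (𝓝[<] u)

/-- `χ` is the tail correlation function of the process `X`: for all `s, t` the limit of
`P(X_s > τ | X_t > τ)`, as `τ` increases to the upper endpoint of the margin, exists and equals
`χ (s, t)`. The conditioning event has positive probability for every `τ` below the endpoint. -/
def IsTailCorrelationOf {T Ω : Type u} [MeasurableSpace Ω] (P : Measure Ω) (X : T → Ω → ℝ)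
    (χ : T × T → ℝ) : Prop :=
  ∀ s t : T, Tendsto (fun τ : ℝ => (P[|{ω | τ < X t ω}]).real {ω | τ < X s ω})
    (thresholdsTo (upperEndpoint (P.map (X t)))) (𝓝 (χ (s, t)))

/-- The set of all tail correlation functions on `T`: those of real-valued stochastic processes
indexed by `T` with identical one-dimensional margins, for which the limits exist. The sample
space may be taken in the universe of `T`, because the path space `T → ℝ` lives there. -/
def TCF (T : Type u) : Set (T × T → ℝ) :=
  {χ | ∃ (Ω : Type u) (_ : MeasurableSpace Ω) (P : Measure Ω) (X : T → Ω → ℝ),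
    IsProbabilityMeasure P ∧ (∀ t, Measurable (X t)) ∧
    (∀ s t, IdentDistrib (X s) (X t) P P) ∧ IsTailCorrelationOf P X χ}

/-- The restriction of `χ : T × T → ℝ` to `M × M`. -/
def restrictPairs {T : Type u} (χ : T × T → ℝ) (M : Finset T) : M × M → ℝ :=
  fun p => χ ((p.1 : T), (p.2 : T))

/-- The solution set in `ℝ^ι` of a finite system of affine inequalities `∑ i, c i * x i ≤ b`,
given by the pairs `(c, b)`. -/
def affineSolutions {ι : Type u} [Fintype ι] (S : Finset ((ι → ℝ) × ℝ)) : Set (ι → ℝ) :=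
  {x | ∀ p ∈ S, ∑ i, p.1 i * x i ≤ p.2}

/-! For finite `M`, `TCF M` is the polytope `correlationPolytope M` of matrices `∑ a_L 1_L ⊗ 1_L`
with unit diagonal. It projects a polyhedron, so Fourier–Motzkin elimination yields the finite
inequality system and closedness. At each threshold the conditional probabilities are normalised
intersection probabilities, hence lie in the polytope, and so does their limit
(`TCF_subset_correlationPolytope`).

Conversely, let all finite restrictions of `χ` lie in these polytopes. For `0 < c ≤ 1`, independent
elementary events with miss probabilities `c ^ a L` give on each finite `M` a random subset in which
`s, t` both occur with probability `1 - 2c + c ^ (2 - χ (s, t))`. This depends on `χ` alone, so weak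
compactness of the probability measures on `{0,1}^T` gives one measure for all of `T`. As `c → 1`,
the pair probability divided by `1 - c` tends to `χ`; mixing such fields at heights `n` gives a
process with tail correlation function `χ` (`mem_TCF_of_asymptotic_events`). -/

/-! ### Polyhedra and Fourier–Motzkin elimination -/

/-- A subset of a real vector space cut out by finitely many affine inequalities. -/
def IsPolyhedron {V : Type*} [AddCommGroup V] [Module ℝ V] (A : Set V) : Prop :=
  ∃ F : Set ((V →ₗ[ℝ] ℝ) × ℝ), F.Finite ∧ A = {v | ∀ p ∈ F, p.1 v ≤ p.2}

namespace IsPolyhedron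

variable {V W : Type*} [AddCommGroup V] [Module ℝ V] [AddCommGroup W] [Module ℝ W]

lemma halfSpace (f : V →ₗ[ℝ] ℝ) (b : ℝ) : IsPolyhedron {v | f v ≤ b} :=
  ⟨{(f, b)}, Set.finite_singleton _, by simp⟩

lemma iInter {ι : Type*} [Finite ι] {A : ι → Set V} (h : ∀ i, IsPolyhedron (A i)) :
    IsPolyhedron (⋂ i, A i) := by
  choose F hF hA using h
  refine ⟨⋃ i, F i, Set.finite_iUnion hF, ?_⟩
  ext v
  simp only [hA, Set.mem_iInter, Set.mem_ofPred_eq, Set.mem_iUnion]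
  exact ⟨fun h p ⟨i, hp⟩ => h i p hp, fun h i p hp => h p ⟨i, hp⟩⟩

lemma inter {A B : Set V} (hA : IsPolyhedron A) (hB : IsPolyhedron B) :
    IsPolyhedron (A ∩ B) := by
  rw [Set.inter_eq_iInter]
  exact iInter fun b => by cases b <;> assumption

lemma hyperplane (f : V →ₗ[ℝ] ℝ) (b : ℝ) : IsPolyhedron {v | f v = b} := by
  convert (halfSpace f b).inter (halfSpace (-f) (-b)) using 1
  ext v
  simp [le_antisymm_iff]

lemma preimage {A : Set W} (hA : IsPolyhedron A) (g : V →ₗ[ℝ] W) :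
    IsPolyhedron (g ⁻¹' A) := by
  obtain ⟨F, hF, rfl⟩ := hA
  refine ⟨(fun p => (p.1 ∘ₗ g, p.2)) '' F, hF.image _, ?_⟩
  ext v
  simp only [Set.mem_preimage, Set.mem_ofPred_eq, Set.forall_mem_image, LinearMap.comp_apply]

lemma exists_between_of_finite {ι : Type*} {s t : Set ι} (hs : s.Finite) (ht : t.Finite)
    {l r : ι → ℝ} (h : ∀ i ∈ s, ∀ j ∈ t, l i ≤ r j) :
    ∃ y, (∀ i ∈ s, l i ≤ y) ∧ ∀ j ∈ t, y ≤ r j := by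
  rcases s.eq_empty_or_nonempty with rfl | hne
  · obtain ⟨y, hy⟩ := (ht.image r).bddBelow
    exact ⟨y, by simp, fun j hj => hy ⟨j, hj, rfl⟩⟩
  · refine ⟨sSup (l '' s), fun i hi => le_csSup (hs.image l).bddAbove ⟨i, hi, rfl⟩,
      fun j hj => csSup_le (hne.image l) ?_⟩
    rintro _ ⟨i, hi, rfl⟩
    exact h i hi j hj

/-- Fourier–Motzkin elimination of one real variable. -/
lemma fst_image_real {A : Set (V × ℝ)} (hA : IsPolyhedron A) :
    IsPolyhedron {v | ∃ y : ℝ, (v, y) ∈ A} := by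
  obtain ⟨F, hF, rfl⟩ := hA
  let d : ((V × ℝ →ₗ[ℝ] ℝ) × ℝ) → ℝ := fun p => p.1 (0, 1)
  let f : ((V × ℝ →ₗ[ℝ] ℝ) × ℝ) → (V →ₗ[ℝ] ℝ) := fun p => p.1 ∘ₗ LinearMap.inl ℝ V ℝ
  have hsplit : ∀ p : (V × ℝ →ₗ[ℝ] ℝ) × ℝ, ∀ v y, p.1 (v, y) = f p v + y * d p := by
    intro p v y
    have : (v, y) = (v, (0 : ℝ)) + y • ((0 : V), (1 : ℝ)) := by simp
    rw [this, map_add, map_smul]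
    rfl
  have hpos : {p ∈ F | 0 < d p}.Finite := hF.sep _
  have hneg : {p ∈ F | d p < 0}.Finite := hF.sep _
  -- Besides the inequalities free of `y`, each pair with opposite signs of `d` is combined with
  -- positive weights that cancel `y`.
  refine ⟨(fun p => (f p, p.2)) '' {p ∈ F | d p = 0} ∪
    Set.image2 (fun p q => (-d q • f p + d p • f q, -d q * p.2 + d p * q.2))
      {p ∈ F | 0 < d p} {p ∈ F | d p < 0}, ((hF.sep _).image _).union (hpos.image2 _ hneg), ?_⟩
  ext v
  simp only [Set.mem_ofPred_eq, hsplit]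
  constructor
  · rintro ⟨y, hy⟩ _ (⟨p, ⟨hp, hd⟩, rfl⟩ | ⟨p, ⟨hp, hdp⟩, q, ⟨hq, hdq⟩, rfl⟩)
    · simpa [hd] using hy p hp
    · have h1 := mul_le_mul_of_nonneg_left (hy p hp) (neg_pos.2 hdq).le
      have h2 := mul_le_mul_of_nonneg_left (hy q hq) hdp.le
      simp only [LinearMap.add_apply, LinearMap.smul_apply, smul_eq_mul]
      linarith
  · intro h
    -- Negative coefficients bound `y` from below, positive ones from above.
    obtain ⟨y, hl, hr⟩ := exists_between_of_finite hneg hpos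
      (l := fun p => (p.2 - f p v) / d p) (r := fun p => (p.2 - f p v) / d p) (by
        rintro q ⟨hq, hdq⟩ p ⟨hp, hdp⟩
        have := h _ (Or.inr ⟨p, ⟨hp, hdp⟩, q, ⟨hq, hdq⟩, rfl⟩)
        simp only [LinearMap.add_apply, LinearMap.smul_apply, smul_eq_mul] at this
        rw [div_le_iff_of_neg hdq, div_mul_eq_mul_div, div_le_iff₀ hdp]
        linarith)
    refine ⟨y, fun p hp => ?_⟩
    rcases lt_trichotomy (d p) 0 with hd | hd | hd
    · have := hl p ⟨hp, hd⟩
      rw [div_le_iff_of_neg hd] at this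
      linarith
    · have := h _ (Or.inl ⟨p, ⟨hp, hd⟩, rfl⟩)
      simpa [hd] using this
    · have := hr p ⟨hp, hd⟩
      rw [le_div_iff₀ hd] at this
      linarith

lemma fst_image_fin (n : ℕ) {V : Type*} [AddCommGroup V] [Module ℝ V]
    {A : Set (V × (Fin n → ℝ))} (hA : IsPolyhedron A) :
    IsPolyhedron {v | ∃ y, (v, y) ∈ A} := by
  induction n generalizing V with
  | zero =>
    convert hA.preimage (LinearMap.inl ℝ V (Fin 0 → ℝ)) using 1
    ext v
    exact ⟨fun ⟨y, hy⟩ => by rwa [Subsingleton.elim y 0] at hy, fun h => ⟨0, h⟩⟩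
  | succ n ih =>
    let g : (V × ℝ) × (Fin n → ℝ) →ₗ[ℝ] V × (Fin (n + 1) → ℝ) :=
      { toFun := fun p => (p.1.1, Fin.cons p.1.2 p.2)
        map_add' := fun p q => by
          refine Prod.ext rfl (funext fun i => ?_)
          cases i using Fin.cases <;> simp
        map_smul' := fun c p => by
          refine Prod.ext rfl (funext fun i => ?_)
          cases i using Fin.cases <;> simp }
    convert (ih (hA.preimage g)).fst_image_real using 1
    ext v
    simp only [Set.mem_ofPred_eq, Set.mem_preimage]
    constructor
    · rintro ⟨y, hy⟩
      exact ⟨y 0, Fin.tail y, by simpa [g] using hy⟩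
    · rintro ⟨y, z, h⟩
      exact ⟨_, h⟩

/-- Projections of polyhedra along finitely many coordinates are polyhedra. -/
lemma fst_image {κ : Type*} [Finite κ] {A : Set (V × (κ → ℝ))} (hA : IsPolyhedron A) :
    IsPolyhedron {v | ∃ y, (v, y) ∈ A} := by
  obtain ⟨n, ⟨e⟩⟩ := Finite.exists_equiv_fin κ
  convert fst_image_fin n
    (hA.preimage (LinearMap.id.prodMap (LinearMap.funLeft ℝ ℝ e))) using 1
  ext v
  simp only [Set.mem_ofPred_eq, Set.mem_preimage, LinearMap.prodMap_apply, LinearMap.id_apply]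
  constructor
  · rintro ⟨y, hy⟩
    refine ⟨y ∘ e.symm, ?_⟩
    convert hy
    ext i
    simp [LinearMap.funLeft]
  · rintro ⟨y, h⟩
    exact ⟨_, h⟩

lemma exists_affineSolutions {ι : Type u} [Fintype ι] {A : Set (ι → ℝ)} (hA : IsPolyhedron A) :
    ∃ S : Finset ((ι → ℝ) × ℝ), A = affineSolutions S := by
  classical
  obtain ⟨F, hF, rfl⟩ := hA
  refine ⟨hF.toFinset.image fun p => (fun i => p.1 (Pi.single i 1), p.2), ?_⟩
  ext v
  have key : ∀ f : (ι → ℝ) →ₗ[ℝ] ℝ, f v = ∑ i, f (Pi.single i 1) * v i := fun f => by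
    rw [f.pi_apply_eq_sum_univ v]
    exact Finset.sum_congr rfl fun i _ => by
      rw [smul_eq_mul, mul_comm]
      congr 2
      ext j
      simp [Pi.single_apply, eq_comm]
  simp only [affineSolutions, Set.mem_ofPred_eq, Finset.mem_image, Set.Finite.mem_toFinset]
  constructor
  · rintro h _ ⟨p, hp, rfl⟩
    simpa [← key] using h p hp
  · intro h p hp
    simpa [← key] using h _ ⟨p, hp, rfl⟩

end IsPolyhedron

lemma isClosed_affineSolutions {ι : Type u} [Fintype ι] (S : Finset ((ι → ℝ) × ℝ)) :
    IsClosed (affineSolutions S) := by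
  simp only [affineSolutions, Set.ofPred_forall]
  exact isClosed_iInter fun p => isClosed_iInter fun _ =>
    isClosed_le (by fun_prop) continuous_const

/-! ### The correlation polytope -/

open Classical in
/-- The matrices `∑ a_L 1_L ⊗ 1_L` over subsets `L`, with `a_L ≥ 0` and unit diagonal. -/
def correlationPolytope (α : Type*) [Fintype α] : Set (α × α → ℝ) :=
  {x | ∃ a : Finset α → ℝ, (∀ L, 0 ≤ a L) ∧ (∀ t, ∑ L with t ∈ L, a L = 1) ∧
    ∀ s t, x (s, t) = ∑ L with s ∈ L ∧ t ∈ L, a L}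

lemma isPolyhedron_correlationPolytope (α : Type*) [Fintype α] :
    IsPolyhedron (correlationPolytope α) := by
  classical
  let e : Finset α → ((α × α → ℝ) × (Finset α → ℝ) →ₗ[ℝ] ℝ) := fun L =>
    LinearMap.proj L ∘ₗ LinearMap.snd ℝ _ _
  let x : α × α → ((α × α → ℝ) × (Finset α → ℝ) →ₗ[ℝ] ℝ) := fun p =>
    LinearMap.proj p ∘ₗ LinearMap.fst ℝ _ _
  have h1 := IsPolyhedron.iInter fun L => IsPolyhedron.halfSpace (-e L) 0
  have h2 := IsPolyhedron.iInter fun t =>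
    IsPolyhedron.hyperplane (∑ L with t ∈ L, e L) 1
  have h3 := IsPolyhedron.iInter fun p : α × α =>
    IsPolyhedron.hyperplane (x p - ∑ L with p.1 ∈ L ∧ p.2 ∈ L, e L) 0
  convert ((h1.inter h2).inter h3).fst_image using 1
  ext v
  simp [correlationPolytope, e, x, sub_eq_zero, and_assoc]

lemma isClosed_correlationPolytope (α : Type u) [Fintype α] :
    IsClosed (correlationPolytope α) := by
  obtain ⟨S, hS⟩ := (isPolyhedron_correlationPolytope α).exists_affineSolutions
  exact hS ▸ isClosed_affineSolutions S

/-! ### Tail correlation functions lie in the polytope -/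

lemma thresholdsTo_neBot {u : EReal} (hu : u ≠ ⊥) : (thresholdsTo u).NeBot := by
  refine comap_neBot fun s hs => ?_
  obtain ⟨l, hl, hls⟩ := (mem_nhdsLT_iff_exists_Ioo_subset' (bot_lt_iff_ne_bot.2 hu)).1 hs
  obtain ⟨x, hlx, hxu⟩ := EReal.lt_iff_exists_real_btwn.1 hl
  exact ⟨x, hls ⟨hlx, hxu⟩⟩

lemma eventually_thresholdsTo_lt (u : EReal) : ∀ᶠ τ in thresholdsTo u, ((τ : ℝ) : EReal) < u :=
  tendsto_comap.eventually eventually_mem_nhdsWithin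

lemma upperEndpoint_ne_bot (μ : Measure ℝ) [IsProbabilityMeasure μ] : upperEndpoint μ ≠ ⊥ := by
  obtain ⟨x, hx⟩ := ((tendsto_cdf_atBot μ).eventually (gt_mem_nhds one_pos)).exists
  rw [cdf_eq_real] at hx
  refine ne_bot_of_le_ne_bot (EReal.coe_ne_bot x) (le_sSup ⟨x, ?_, rfl⟩)
  by_contra h
  simp only [Set.mem_ofPred_eq, not_lt] at h
  have h1 : μ (Set.Iic x) = 1 := le_antisymm prob_le_one h
  simp [measureReal_def, h1] at hx

lemma measure_Ioi_pos_of_lt_upperEndpoint {μ : Measure ℝ} [IsProbabilityMeasure μ] {τ : ℝ}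
    (h : (τ : EReal) < upperEndpoint μ) : 0 < μ (Set.Ioi τ) := by
  obtain ⟨_, ⟨x, hx, rfl⟩, hτ⟩ := lt_sSup_iff.1 h
  have h1 : μ (Set.Iic τ) < 1 :=
    (measure_mono (Set.Iic_subset_Iic.2 (EReal.coe_lt_coe_iff.1 hτ).le)).trans_lt hx
  rw [← Set.compl_Iic, prob_compl_eq_one_sub measurableSet_Iic]
  exact tsub_pos_of_lt h1

open Classical in
/-- Pairwise intersection probabilities of events of common probability, normalised by it. -/
lemma mem_correlationPolytope_of_events {α Ω : Type*} [Fintype α] [MeasurableSpace Ω]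
    (P : Measure Ω) [IsProbabilityMeasure P] (A : α → Set Ω) (hA : ∀ t, MeasurableSet (A t))
    {p : ℝ} (hp : 0 < p) (hP : ∀ t, P.real (A t) = p) :
    (fun q : α × α => p⁻¹ * P.real (A q.1 ∩ A q.2)) ∈ correlationPolytope α := by
  let N : Ω → Finset α := fun ω => {t | ω ∈ A t}
  let _ : MeasurableSpace (Finset α) := ⊤
  have hN : Measurable N := by
    have h1 : ∀ L : Finset α, N ⁻¹' {L} = ⋂ t, if t ∈ L then A t else (A t)ᶜ := by
      intro L
      ext ω
      simp only [N, Set.mem_preimage, Set.mem_singleton_iff, Finset.ext_iff, Finset.mem_filter,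
        Finset.mem_univ, true_and, Set.mem_iInter]
      refine forall_congr' fun t => ?_
      by_cases h : t ∈ L <;> simp [h]
    refine measurable_to_countable' fun L => ?_
    rw [h1]
    refine MeasurableSet.iInter fun t => ?_
    split_ifs
    · exact hA t
    · exact (hA t).compl
  have key : ∀ (Q : Finset α → Prop) [DecidablePred Q],
      ∑ L with Q L, P.real (N ⁻¹' {L}) = P.real {ω | Q (N ω)} := by
    intro Q _
    rw [sum_measureReal_preimage_singleton _ fun L _ => hN (measurableSet_singleton L)]
    congr 1
    ext ω
    simp
  -- The weight of `L` is the normalised probability that exactly the events indexed by `L` occur.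
  refine ⟨fun L => p⁻¹ * P.real (N ⁻¹' {L}), fun L => by positivity, fun t => ?_, fun s t => ?_⟩
  · rw [← Finset.mul_sum, key fun L => t ∈ L]
    have : {ω | t ∈ N ω} = A t := by ext; simp [N]
    rw [this, hP, inv_mul_cancel₀ hp.ne']
  · have : {ω | s ∈ N ω ∧ t ∈ N ω} = A s ∩ A t := by ext; simp [N]
    rw [← Finset.mul_sum, key fun L => s ∈ L ∧ t ∈ L, this]

lemma TCF_subset_correlationPolytope (α : Type u) [Fintype α] :
    TCF α ⊆ correlationPolytope α := by
  rintro χ ⟨Ω, _, P, X, _, hX, hid, hχ⟩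
  rcases isEmpty_or_nonempty α with hα | ⟨⟨t₀⟩⟩
  · exact ⟨0, fun _ => le_rfl, fun t => hα.elim t, fun t => hα.elim t⟩
  have hmap : ∀ t, P.map (X t) = P.map (X t₀) := fun t => (hid t t₀).map_eq
  have : IsProbabilityMeasure (P.map (X t₀)) :=
    Measure.isProbabilityMeasure_map (hX t₀).aemeasurable
  set u := upperEndpoint (P.map (X t₀)) with hu
  have : (thresholdsTo u).NeBot := thresholdsTo_neBot (upperEndpoint_ne_bot _)
  have hset : ∀ t τ, {ω | τ < X t ω} = X t ⁻¹' Set.Ioi τ := fun _ _ => rfl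
  have hmeas : ∀ t τ, MeasurableSet {ω | τ < X t ω} := fun t τ => hX t measurableSet_Ioi
  have hlim : Tendsto (fun τ : ℝ => fun q : α × α =>
      (P[|{ω | τ < X q.2 ω}]).real {ω | τ < X q.1 ω}) (thresholdsTo u) (𝓝 χ) := by
    refine tendsto_pi_nhds.2 fun q => ?_
    have := hχ q.1 q.2
    rwa [hmap, ← hu] at this
  refine (isClosed_correlationPolytope α).mem_of_tendsto hlim ?_
  filter_upwards [eventually_thresholdsTo_lt u] with τ hτ
  have hp : ∀ t, P.real {ω | τ < X t ω} = (P.map (X t₀)).real (Set.Ioi τ) := fun t => by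
    rw [← hmap t, map_measureReal_apply (hX t) measurableSet_Ioi, hset]
  have hpos : 0 < (P.map (X t₀)).real (Set.Ioi τ) :=
    ENNReal.toReal_pos (measure_Ioi_pos_of_lt_upperEndpoint hτ).ne' (measure_ne_top _ _)
  convert mem_correlationPolytope_of_events P (fun t => {ω | τ < X t ω}) (hmeas · τ) hpos hp
    using 2 with q
  rw [measureReal_def, cond_apply (hmeas _ _), ENNReal.toReal_mul, ENNReal.toReal_inv,
    ← measureReal_def, ← measureReal_def, hp, Set.inter_comm]

lemma restrictPairs_mem_TCF {T : Type u} {χ : T × T → ℝ} (h : χ ∈ TCF T) (M : Finset T) :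
    restrictPairs χ M ∈ TCF M := by
  obtain ⟨Ω, m, P, X, hP, hX, hid, hχ⟩ := h
  exact ⟨Ω, m, P, fun t => X t, hP, fun t => hX t, fun s t => hid s t, fun s t => hχ s t⟩

/-! ### Random subsets built from independent events -/

lemma exists_independent_miss_probability {K : Type*} [Fintype K] {a : K → ℝ}
    (ha : ∀ L, 0 ≤ a L) {c : ℝ} (hc : 0 < c) (hc1 : c ≤ 1) :
    ∃ ν : Measure (K → Bool), IsProbabilityMeasure ν ∧
      ∀ F : Finset K, ν.real {ω | ∀ L ∈ F, ω L = false} = c ^ (∑ L ∈ F, a L) := by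
  classical
  have hp : ∀ L, c ^ a L ∈ unitInterval := fun L =>
    ⟨by positivity, Real.rpow_le_one hc.le hc1 (ha L)⟩
  let β : K → Measure Bool := fun L => bernoulliMeasure false true ⟨c ^ a L, hp L⟩
  have hβ : ∀ L, IsProbabilityMeasure (β L) := fun L => by dsimp only [β]; infer_instance
  refine ⟨Measure.pi β, inferInstance, fun F => ?_⟩
  have hset : {ω : K → Bool | ∀ L ∈ F, ω L = false} =
      Set.univ.pi fun L => if L ∈ F then {false} else Set.univ := by
    ext ω
    simp only [Set.mem_ofPred_eq, Set.mem_pi, Set.mem_univ, true_imp_iff]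
    refine forall_congr' fun L => ?_
    by_cases h : L ∈ F <;> simp [h]
  have hL : ∀ L, (β L).real (if L ∈ F then {false} else Set.univ) =
      if L ∈ F then c ^ a L else 1 := by
    intro L
    split_ifs
    · simp [β]
    · exact probReal_univ
  rw [hset, measureReal_def, Measure.pi_pi, ENNReal.toReal_prod]
  simp only [← measureReal_def, hL, Finset.prod_ite_mem, Finset.univ_inter]
  exact (Real.rpow_sum_of_pos hc _ _).symm

/-- Events that are unions of independent elementary events of miss probabilities `c ^ a L`. -/
lemma exists_measure_inter_of_independent {K T : Type*} [Fintype K] [DecidableEq K]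
    [m : MeasurableSpace (T → Bool)] (hm : ∀ t, MeasurableSet {B : T → Bool | B t = true})
    {a : K → ℝ} (ha : ∀ L, 0 ≤ a L) (R : T → Finset K) {c : ℝ} (hc : 0 < c) (hc1 : c ≤ 1) :
    ∃ μ : Measure (T → Bool), IsProbabilityMeasure μ ∧ ∀ s t,
      μ.real ({B | B s = true} ∩ {B | B t = true}) =
        1 - c ^ (∑ L ∈ R s, a L) - c ^ (∑ L ∈ R t, a L) + c ^ (∑ L ∈ R s ∪ R t, a L) := by
  obtain ⟨ν, _, hν⟩ := exists_independent_miss_probability ha hc hc1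
  let Φ : (K → Bool) → T → Bool := fun ω t => decide (∃ L ∈ R t, ω L = true)
  have hΦ : Measurable Φ := measurable_of_finite Φ
  refine ⟨ν.map Φ, Measure.isProbabilityMeasure_map hΦ.aemeasurable, fun s t => ?_⟩
  rw [map_measureReal_apply hΦ ((hm s).inter (hm t))]
  let miss : T → Set (K → Bool) := fun t => {ω | ∀ L ∈ R t, ω L = false}
  have hpre : Φ ⁻¹' ({B | B s = true} ∩ {B | B t = true}) = (miss s ∪ miss t)ᶜ := by
    ext ω
    simp [Φ, miss]
  have hinter : miss s ∩ miss t = {ω | ∀ L ∈ R s ∪ R t, ω L = false} := by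
    ext ω
    simp only [miss, Set.mem_inter_iff, Set.mem_ofPred_eq, Finset.mem_union, or_imp,
      forall_and]
  have hadd := measureReal_union_add_inter (μ := ν) (s := miss s) (t := miss t)
    (Set.toFinite _).measurableSet
  rw [hinter, hν, hν, hν] at hadd
  rw [hpre, probReal_compl_eq_one_sub (Set.toFinite _).measurableSet]
  linarith

/-- Point `t` occurs when some elementary event `L ∋ t` does. Independence, unlike disjoint events
of probability proportional to `a L`, needs no bound on `∑ a L`, so one `c` serves every `M`. The
exponent `2 - χ (s, t)` is the weight of the sets `L` meeting `{s, t}`. -/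
lemma restrictPairs_correlationPolytope_measure {T : Type u} {χ : T × T → ℝ} {M : Finset T}
    (h : restrictPairs χ M ∈ correlationPolytope M) [MeasurableSpace (T → Bool)]
    (hm : ∀ t, MeasurableSet {B : T → Bool | B t = true}) {c : ℝ} (hc : 0 < c) (hc1 : c ≤ 1) :
    ∃ μ : Measure (T → Bool), IsProbabilityMeasure μ ∧ ∀ s ∈ M, ∀ t ∈ M,
      μ.real ({B | B s = true} ∩ {B | B t = true}) = 1 - 2 * c + c ^ (2 - χ (s, t)) := by
  classical
  obtain ⟨a, ha, hdiag, hχ⟩ := h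
  obtain ⟨μ, hμ, hμR⟩ := exists_measure_inter_of_independent hm ha
    (fun t => {L : Finset M | ∃ h : t ∈ M, (⟨t, h⟩ : M) ∈ L}) hc hc1
  refine ⟨μ, hμ, fun s hs t ht => ?_⟩
  have hd : ∀ t (ht : t ∈ M), ∑ L : Finset M with ∃ h : t ∈ M, (⟨t, h⟩ : M) ∈ L, a L = 1 := by
    intro t ht
    rw [← hdiag ⟨t, ht⟩]
    exact Finset.sum_congr (by ext; simp [ht]) fun _ _ => rfl
  have hx := hχ ⟨s, hs⟩ ⟨t, ht⟩
  have hui := Finset.sum_union_inter (f := a)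
    (s₁ := ({L : Finset M | ∃ h : s ∈ M, (⟨s, h⟩ : M) ∈ L} : Finset (Finset M)))
    (s₂ := ({L : Finset M | ∃ h : t ∈ M, (⟨t, h⟩ : M) ∈ L} : Finset (Finset M)))
  have hi : ∑ L ∈ ({L : Finset M | ∃ h : s ∈ M, (⟨s, h⟩ : M) ∈ L} : Finset (Finset M)) ∩
      ({L : Finset M | ∃ h : t ∈ M, (⟨t, h⟩ : M) ∈ L} : Finset (Finset M)), a L = χ (s, t) := by
    refine Eq.trans ?_ hx.symm
    exact Finset.sum_congr (by ext; simp [hs, ht]) fun _ _ => rfl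
  rw [hμR, hd s hs, hd t ht, Real.rpow_one]
  rw [hi, hd s hs, hd t ht] at hui
  rw [show 2 - χ (s, t) = _ from sub_eq_of_eq_add (by rw [hui]; norm_num)]
  ring

/-! ### Passage to an arbitrary index set by compactness -/

/-- Prescribed probabilities of clopen events in a compact space are realised by a probability
measure as soon as any finitely many of them are. -/
lemma exists_probabilityMeasure_of_forall_finset {E ι : Type*} [TopologicalSpace E] [CompactSpace E]
    [T2Space E] [MeasurableSpace E] [BorelSpace E] {C : ι → Set E} (hC : ∀ i, IsClopen (C i))
    (v : ι → ℝ) (h : ∀ J : Finset ι, ∃ μ : Measure E, IsProbabilityMeasure μ ∧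
      ∀ i ∈ J, μ.real (C i) = v i) :
    ∃ μ : Measure E, IsProbabilityMeasure μ ∧ ∀ i, μ.real (C i) = v i := by
  -- The indicator of a clopen set is continuous, so its integral is weakly continuous in the
  -- measure.
  have hcont : ∀ i, Continuous fun μ : ProbabilityMeasure E => (μ : Measure E).real (C i) := by
    intro i
    convert ProbabilityMeasure.continuous_integral_boundedContinuousFunction
      (BoundedContinuousFunction.indicator (C i) (hC i)) using 2 with μ
    have := integral_indicator_one (μ := (μ : Measure E)) (hC i).isClosed.measurableSet
    rw [← this]
    rfl
  obtain ⟨μ, hμ⟩ := CompactSpace.iInter_nonempty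
    (t := fun i => {μ : ProbabilityMeasure E | (μ : Measure E).real (C i) = v i})
    (fun i => isClosed_eq (hcont i) continuous_const) (fun J => by
      obtain ⟨μ, hμ, hJ⟩ := h J
      exact ⟨⟨μ, hμ⟩, Set.mem_iInter₂.2 hJ⟩)
  exact ⟨μ, μ.2, Set.mem_iInter.1 hμ⟩

lemma measurableSet_eval_true {T : Type*} (t : T) : MeasurableSet {B : T → Bool | B t = true} :=
  @measurable_pi_apply T (fun _ => Bool) _ t _ (measurableSet_singleton true)

lemma exists_measure_of_forall_restrictPairs {T : Type u} {χ : T × T → ℝ}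
    (h : ∀ M : Finset T, M.Nonempty → restrictPairs χ M ∈ correlationPolytope M)
    {c : ℝ} (hc : 0 < c) (hc1 : c ≤ 1) :
    ∃ μ : Measure (T → Bool), IsProbabilityMeasure μ ∧ ∀ s t,
      μ.real ({B | B s = true} ∩ {B | B t = true}) = 1 - 2 * c + c ^ (2 - χ (s, t)) := by
  classical
  have hclopen : ∀ t : T, IsClopen {B : T → Bool | B t = true} := fun t =>
    (isClopen_discrete {true}).preimage (continuous_apply t)
  -- For uncountable `T` the Borel σ-algebra exceeds the product one: compactness is used for Borel
  -- measures, and the result is then restricted.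
  have hle : (MeasurableSpace.pi : MeasurableSpace (T → Bool)) ≤ borel (T → Bool) :=
    pi_le_borel_pi
  obtain ⟨μ, hμ, hval⟩ : ∃ μ : @Measure (T → Bool) (borel _), IsProbabilityMeasure μ ∧
      ∀ p : T × T, μ.real ({B | B p.1 = true} ∩ {B | B p.2 = true}) =
        1 - 2 * c + c ^ (2 - χ p) := by
    let _ : MeasurableSpace (T → Bool) := borel _
    have : BorelSpace (T → Bool) := ⟨rfl⟩
    refine exists_probabilityMeasure_of_forall_finset
      (fun p : T × T => (hclopen p.1).inter (hclopen p.2)) _ fun J => ?_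
    rcases J.eq_empty_or_nonempty with rfl | ⟨p, hp⟩
    · exact ⟨Measure.dirac fun _ => false, inferInstance, by simp⟩
    let M := J.image Prod.fst ∪ J.image Prod.snd
    have h1 : ∀ q ∈ J, q.1 ∈ M := fun q hq =>
      Finset.mem_union_left _ (Finset.mem_image_of_mem _ hq)
    have h2 : ∀ q ∈ J, q.2 ∈ M := fun q hq =>
      Finset.mem_union_right _ (Finset.mem_image_of_mem _ hq)
    obtain ⟨μ, hμ, hM⟩ := restrictPairs_correlationPolytope_measure (h M ⟨_, h1 p hp⟩)
      (fun t => (hclopen t).isClosed.measurableSet) hc hc1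
    exact ⟨μ, hμ, fun q hq => hM _ (h1 q hq) _ (h2 q hq)⟩
  refine ⟨μ.trim hle, ⟨by rw [trim_measurableSet_eq hle .univ, measure_univ]⟩, fun s t => ?_⟩
  rw [← hval (s, t), measureReal_def, measureReal_def, trim_measurableSet_eq hle]
  exact (measurableSet_eval_true s).inter (measurableSet_eval_true t)

/-! ### From random subsets to a process -/

/-- Numerator and denominator vanish at `l = 0`, with derivatives `2 - (2 - x) = x` and `1` there.
-/
lemma tendsto_cooccurrence_ratio (x : ℝ) {l : ℕ → ℝ} (hl : Tendsto l atTop (𝓝 0))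
    (hl0 : ∀ n, l n ≠ 0) :
    Tendsto (fun n => (1 - 2 * Real.exp (-l n) + Real.exp (-l n) ^ (2 - x)) /
      (1 - Real.exp (-l n))) atTop (𝓝 x) := by
  have hl' : Tendsto l atTop (𝓝[≠] 0) :=
    tendsto_nhdsWithin_iff.2 ⟨hl, .of_forall hl0⟩
  have he : ∀ k : ℝ, HasDerivAt (fun y : ℝ => Real.exp (-y * k)) (-k) 0 := fun k => by
    simpa using ((hasDerivAt_id (0 : ℝ)).neg.mul_const k).exp
  have hf : HasDerivAt (fun y : ℝ => 1 - 2 * Real.exp (-y * 1) + Real.exp (-y * (2 - x))) x 0 :=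
    ((((he 1).const_mul 2).const_sub 1).add (he (2 - x))).congr_deriv (by ring)
  have hg : HasDerivAt (fun y : ℝ => 1 - Real.exp (-y * 1)) 1 0 :=
    ((he 1).const_sub 1).congr_deriv (by ring)
  have := (hf.tendsto_slope_zero.comp hl').div (hg.tendsto_slope_zero.comp hl') one_ne_zero
  rw [div_one] at this
  refine this.congr fun n => ?_
  have hn := hl0 n
  simp only [Pi.div_apply, Function.comp_apply, zero_add, smul_eq_mul, mul_one, neg_zero, zero_mul,
    Real.exp_zero, sub_self, sub_zero, Real.exp_mul (-l n) (2 - x)]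
  rw [mul_div_mul_left _ _ (inv_ne_zero hn)]
  congr 1
  ring

/-- Mixture of probability measures with weights `w`, remembering the label. -/
lemma exists_labelled_mixture {E : Type*} [MeasurableSpace E] {w : ℕ → ℝ} (hw : ∀ n, 0 ≤ w n)
    (hw1 : HasSum w 1) (μ : ℕ → Measure E) [∀ n, IsProbabilityMeasure (μ n)] :
    ∃ P : Measure (ℕ × E), IsProbabilityMeasure P ∧ ∀ S, MeasurableSet S →
      HasSum (fun n => w n * (μ n).real (Prod.mk n ⁻¹' S)) (P.real S) := by
  let P : Measure (ℕ × E) :=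
    Measure.sum fun n => ENNReal.ofReal (w n) • (μ n).map (Prod.mk n)
  have hsum : ∀ S, Summable fun n => w n * (μ n).real (Prod.mk n ⁻¹' S) := fun S =>
    hw1.summable.of_nonneg_of_le (fun n => mul_nonneg (hw n) measureReal_nonneg)
      fun n => mul_le_of_le_one_right (hw n) measureReal_le_one
  have hP : ∀ S, MeasurableSet S →
      P S = ENNReal.ofReal (∑' n, w n * (μ n).real (Prod.mk n ⁻¹' S)) := by
    intro S hS
    rw [Measure.sum_apply _ hS,
      ENNReal.ofReal_tsum_of_nonneg (fun n => mul_nonneg (hw n) measureReal_nonneg) (hsum S)]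
    refine tsum_congr fun n => ?_
    rw [Measure.smul_apply, smul_eq_mul, Measure.map_apply measurable_prodMk_left hS,
      ENNReal.ofReal_mul (hw n), ofReal_measureReal]
  refine ⟨P, ⟨?_⟩, fun S hS => ?_⟩
  · rw [hP _ .univ]
    simp [hw1.tsum_eq]
  · rw [measureReal_def, hP S hS, ENNReal.toReal_ofReal
      (tsum_nonneg fun n => mul_nonneg (hw n) measureReal_nonneg)]
    exact (hsum S).hasSum

lemma map_eval_eq_of_measureReal_eq {T : Type*} (μ : Measure (T → Bool)) [IsProbabilityMeasure μ]
    {s t : T} (h : μ.real {B | B s = true} = μ.real {B | B t = true}) :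
    μ.map (fun B => B s) = μ.map (fun B => B t) := by
  have hm : ∀ t : T, Measurable fun B : T → Bool => B t := fun t => measurable_pi_apply t
  have h1 : ∀ t, μ.map (fun B => B t) {true} = μ {B | B t = true} := fun t =>
    Measure.map_apply (hm t) (measurableSet_singleton true)
  have h2 : μ {B | B s = true} = μ {B | B t = true} :=
    (measureReal_eq_measureReal_iff).1 h
  have hp : ∀ t, IsProbabilityMeasure (μ.map fun B => B t) := fun t =>
    Measure.isProbabilityMeasure_map (hm t).aemeasurable
  refine Measure.ext_of_singleton fun b => ?_
  cases b
  · rw [show ({false} : Set Bool) = {true}ᶜ by ext b; cases b <;> simp,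
      prob_compl_eq_one_sub (measurableSet_singleton true),
      prob_compl_eq_one_sub (measurableSet_singleton true), h1, h1, h2]
  · rw [h1, h1, h2]

lemma upperEndpoint_eq_top {μ : Measure ℝ} [IsProbabilityMeasure μ]
    (h : ∀ x, 0 < μ (Set.Ioi x)) : upperEndpoint μ = ⊤ := by
  refine EReal.eq_top_iff_forall_lt _ |>.2 fun y => ?_
  refine lt_of_lt_of_le (EReal.coe_lt_coe_iff.2 (lt_add_one y)) (le_sSup ⟨y + 1, ?_, rfl⟩)
  rw [Set.mem_ofPred_eq, ← Set.compl_Ioi, prob_compl_eq_one_sub measurableSet_Ioi]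
  exact ENNReal.sub_lt_self ENNReal.one_ne_top one_ne_zero (h _).ne'

lemma thresholdsTo_top_le_atTop : thresholdsTo ⊤ ≤ atTop := by
  refine tendsto_id'.1 (tendsto_atTop.2 fun b => ?_)
  have : ∀ᶠ x : EReal in 𝓝[<] ⊤, (b : EReal) < x :=
    nhdsWithin_le_nhds (Ioi_mem_nhds (EReal.coe_lt_top b))
  filter_upwards [tendsto_comap.eventually this] with τ hτ
  exact (EReal.coe_lt_coe_iff.1 hτ).le

/-- Random fields of events with pairwise ratios tending to `χ`, mixed at heights `n`. -/
lemma mem_TCF_of_asymptotic_events {T : Type u} {χ : T × T → ℝ}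
    (μ : ℕ → Measure (T → Bool)) [∀ n, IsProbabilityMeasure (μ n)] {p : ℕ → ℝ}
    (hp : ∀ n, 0 < p n) (hμ : ∀ n t, (μ n).real {B | B t = true} = p n)
    (hχ : ∀ s t, Tendsto (fun n => (μ n).real ({B | B s = true} ∩ {B | B t = true}) / p n)
      atTop (𝓝 (χ (s, t)))) :
    χ ∈ TCF T := by
  obtain ⟨P, hP, hsum⟩ := exists_labelled_mixture (fun n => by positivity)
    (w := fun n => 1 / 2 / 2 ^ n) (hasSum_geometric_two' 1) μ
  -- For `τ ≥ 0`, exceeding `τ` means that the label is above `τ` and `t` belongs to the random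
  -- subset.
  let X : T → ℕ × (T → Bool) → ℝ := fun t ω => if ω.2 t = true then (ω.1 : ℝ) else 0
  have hX : ∀ t, Measurable (X t) := fun t =>
    Measurable.ite (measurable_snd (measurableSet_eval_true t))
      (measurable_from_top.comp measurable_fst) measurable_const
  have hmap : ∀ s t, P.map (X s) = P.map (X t) := by
    intro s t
    ext S hS
    rw [Measure.map_apply (hX s) hS, Measure.map_apply (hX t) hS, ← measureReal_eq_measureReal_iff]
    refine (hsum _ (hX s hS)).unique ?_
    convert hsum _ (hX t hS) using 3 with n
    have hpre : ∀ r : T, (Prod.mk n ⁻¹' (X r ⁻¹' S) : Set (T → Bool)) =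
        (fun B : T → Bool => B r) ⁻¹' {b | (if b = true then (n : ℝ) else 0) ∈ S} :=
      fun r => rfl
    have hm : ∀ r : T, Measurable fun B : T → Bool => B r := fun r => measurable_pi_apply r
    rw [hpre, hpre, ← map_measureReal_apply (hm s) (Set.toFinite _).measurableSet,
      ← map_measureReal_apply (hm t) (Set.toFinite _).measurableSet,
      map_eval_eq_of_measureReal_eq (μ n) ((hμ n s).trans (hμ n t).symm)]
  have hexc : ∀ t (τ : ℝ), MeasurableSet {ω | τ < X t ω} := fun t τ => hX t measurableSet_Ioi
  have hslice : ∀ t {τ : ℝ}, 0 ≤ τ → ∀ n : ℕ, (Prod.mk n ⁻¹' {ω | τ < X t ω} : Set (T → Bool)) =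
      if τ < n then {B | B t = true} else ∅ := by
    intro t τ hτ n
    ext B
    by_cases hB : B t = true <;> by_cases hn : τ < n <;> simp [X, hB, hn, hτ]
  have htail : ∀ t {τ : ℝ}, 0 ≤ τ → HasSum
      (fun n : ℕ => 1 / 2 / 2 ^ n * if τ < n then p n else 0) (P.real {ω | τ < X t ω}) := by
    intro t τ hτ
    convert hsum _ (hexc t τ) using 3 with n
    rw [hslice t hτ]
    split_ifs
    · exact (hμ n t).symm
    · simp
  have hpair : ∀ s t {τ : ℝ}, 0 ≤ τ → HasSum
      (fun n : ℕ => 1 / 2 / 2 ^ n * if τ < n then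
        (μ n).real ({B | B s = true} ∩ {B | B t = true}) else 0)
      (P.real ({ω | τ < X s ω} ∩ {ω | τ < X t ω})) := by
    intro s t τ hτ
    convert hsum _ ((hexc s τ).inter (hexc t τ)) using 3 with n
    rw [Set.preimage_inter, hslice s hτ, hslice t hτ]
    split_ifs <;> simp
  have hpos : ∀ t {τ : ℝ}, 0 ≤ τ → 0 < P.real {ω | τ < X t ω} := by
    intro t τ hτ
    obtain ⟨n, hn⟩ := exists_nat_gt τ
    refine lt_of_lt_of_le ?_ (le_hasSum (htail t hτ) n fun k _ => ?_)
    · rw [if_pos hn]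
      exact mul_pos (by positivity) (hp n)
    · split_ifs
      · exact mul_nonneg (by positivity) (hp k).le
      · simp
  refine ⟨ℕ × (T → Bool), inferInstance, P, X, hP, hX, fun s t =>
    ⟨(hX s).aemeasurable, (hX t).aemeasurable, hmap s t⟩, fun s t => ?_⟩
  have : IsProbabilityMeasure (P.map (X t)) := Measure.isProbabilityMeasure_map (hX t).aemeasurable
  have htop : upperEndpoint (P.map (X t)) = ⊤ := upperEndpoint_eq_top fun x => by
    rw [Measure.map_apply (hX t) measurableSet_Ioi]
    refine lt_of_lt_of_le (ENNReal.toReal_pos_iff.1 (hpos t (le_max_right x 0))).1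
      (measure_mono fun ω (hω : max x 0 < X t ω) => (le_max_left x 0).trans_lt hω)
  rw [htop]
  refine Tendsto.mono_left ?_ thresholdsTo_top_le_atTop
  refine Metric.tendsto_atTop.2 fun ε hε => ?_
  -- Only labels `n > τ ≥ N` contribute, each with error at most `ε / 2` times its share of the
  -- tail. Summation preserves only `≤`; the factor `1 / 2` restores strictness.
  obtain ⟨N, hN⟩ := Metric.tendsto_atTop.1 (hχ s t) (ε / 2) (half_pos hε)
  refine ⟨N, fun τ hτ => ?_⟩
  have hτ0 : 0 ≤ τ := N.cast_nonneg.trans hτ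
  have hq := hpos t hτ0
  rw [measureReal_def, cond_apply (hexc _ _), ENNReal.toReal_mul, ENNReal.toReal_inv,
    ← measureReal_def, ← measureReal_def, Set.inter_comm, Real.dist_eq, inv_mul_eq_div,
    div_sub' hq.ne', abs_div, abs_of_pos hq, div_lt_iff₀ hq]
  refine lt_of_le_of_lt ?_ (mul_lt_mul_of_pos_right (half_lt_self hε) hq)
  have hd := (hpair s t hτ0).sub ((htail t hτ0).mul_right (χ (s, t)))
  have hb := (htail t hτ0).mul_left (ε / 2)
  rw [← hd.tsum_eq, ← hb.tsum_eq, ← Real.norm_eq_abs]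
  refine tsum_of_norm_bounded hb.summable.hasSum fun n => ?_
  rw [Real.norm_eq_abs]
  split_ifs with hn
  · have h1 := hN n (by exact_mod_cast hτ.trans hn.le)
    have hpn := hp n
    rw [Real.dist_eq, div_sub' hpn.ne', abs_div, abs_of_pos hpn, div_lt_iff₀ hpn] at h1
    rw [mul_assoc, ← mul_sub, abs_mul, abs_of_pos (by positivity), mul_left_comm]
    gcongr
  · simp

/-! ### Identification of the tail correlation functions -/

lemma mem_TCF_of_forall_restrictPairs {T : Type u} {χ : T × T → ℝ}
    (h : ∀ M : Finset T, M.Nonempty → restrictPairs χ M ∈ correlationPolytope M) :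
    χ ∈ TCF T := by
  let l : ℕ → ℝ := fun n => 1 / ((n : ℝ) + 1)
  have hl : ∀ n, 0 < l n := fun n => by positivity
  have hdiag : ∀ t, χ (t, t) = 1 := fun t => by
    obtain ⟨a, -, hd, hχ⟩ := h {t} (Finset.singleton_nonempty t)
    let t' : ({t} : Finset T) := ⟨t, Finset.mem_singleton_self t⟩
    have := hχ t' t'
    simp only [and_self] at this
    refine Eq.trans this (Eq.trans ?_ (hd t'))
    exact Finset.sum_congr (by ext; simp) fun _ _ => rfl
  have hc1 : ∀ n, Real.exp (-l n) < 1 := fun n => Real.exp_lt_one_iff.2 (neg_neg_of_pos (hl n))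
  choose μ hμ hpair using fun n =>
    exists_measure_of_forall_restrictPairs h (Real.exp_pos (-l n)) (hc1 n).le
  refine mem_TCF_of_asymptotic_events μ (p := fun n => 1 - Real.exp (-l n))
    (fun n => sub_pos.2 (hc1 n)) (fun n t => ?_) fun s t => ?_
  · have := hpair n t t
    -- On the diagonal the pair probability becomes `1 - 2c + c = 1 - c`.
    rw [Set.inter_self, hdiag, show (2 : ℝ) - 1 = 1 by norm_num, Real.rpow_one] at this
    rw [this]
    ring
  · simp only [hpair]
    exact tendsto_cooccurrence_ratio _ tendsto_one_div_add_atTop_nhds_zero_nat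
      fun n => (hl n).ne'

open Classical in
lemma restrictPairs_mem_correlationPolytope {T : Type u} [Fintype T] {χ : T × T → ℝ}
    (h : χ ∈ correlationPolytope T) (M : Finset T) :
    restrictPairs χ M ∈ correlationPolytope M := by
  obtain ⟨a, ha, hd, hχ⟩ := h
  -- The weights are pushed forward along `L ↦ L ∩ M`.
  let g : Finset T → Finset M := fun L => {t | (t : T) ∈ L}
  have key : ∀ (Q : Finset M → Prop) [DecidablePred Q],
      ∑ L' with Q L', ∑ L with g L = L', a L = ∑ L with Q (g L), a L := by
    intro Q _
    rw [Finset.sum_fiberwise_eq_sum_filter]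
    simp
  refine ⟨fun L' => ∑ L with g L = L', a L, fun L' => Finset.sum_nonneg fun L _ => ha L,
    fun t => ?_, fun s t => ?_⟩
  · refine (Eq.trans ?_ (key fun L' => t ∈ L')).trans (Eq.trans ?_ (hd t)) <;>
    exact Finset.sum_congr (by ext; simp [g]) fun _ _ => rfl
  · refine (hχ s t).trans (Eq.trans ?_ (Eq.trans (key fun L' => s ∈ L' ∧ t ∈ L').symm ?_)) <;>
    exact Finset.sum_congr (by ext; simp [g]) fun _ _ => rfl

lemma TCF_eq_correlationPolytope (α : Type u) [Fintype α] : TCF α = correlationPolytope α :=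
  (TCF_subset_correlationPolytope α).antisymm fun _ h =>
    mem_TCF_of_forall_restrictPairs fun M _ => restrictPairs_mem_correlationPolytope h M

lemma mem_TCF_iff_forall_restrictPairs {T : Type u} (χ : T × T → ℝ) :
    χ ∈ TCF T ↔ ∀ M : Finset T, M.Nonempty → restrictPairs χ M ∈ TCF M :=
  ⟨fun h M _ => restrictPairs_mem_TCF h M, fun h => mem_TCF_of_forall_restrictPairs fun M hM =>
    TCF_subset_correlationPolytope M (h M hM)⟩

theorem mainTheorem3 (T : Type u) :
    (∀ χ : T × T → ℝ,
      χ ∈ TCF T ↔ ∀ M : Finset T, M.Nonempty → restrictPairs χ M ∈ TCF M) ∧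
    ∃ S : (M : Finset T) → Finset ((M × M → ℝ) × ℝ),
      (∀ M : Finset T, M.Nonempty → TCF M = affineSolutions (S M)) ∧
      TCF T = {χ : T × T → ℝ |
        ∀ M : Finset T, M.Nonempty → restrictPairs χ M ∈ affineSolutions (S M)} := by
  refine ⟨mem_TCF_iff_forall_restrictPairs, ?_⟩
  choose S hS using fun M : Finset T =>
    (isPolyhedron_correlationPolytope M).exists_affineSolutions
  have hTCF : ∀ M : Finset T, TCF M = affineSolutions (S M) := fun M =>
    (TCF_eq_correlationPolytope M).trans (hS M)
  refine ⟨S, fun M _ => hTCF M, ?_⟩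
  ext χ
  simp only [mem_TCF_iff_forall_restrictPairs χ, hTCF, Set.mem_ofPred_eq]
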